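/- Semigroups are not assumed commutative and are written additively; $\mathbb N=\{1,2,3,\dots\}$. For a sequence $a_1,a_2,\dots$ in a semigroup $S$ and a nonempty finite set $F=\{i_1<\dots<i_m\}\subseteq\mathbb N$, let $a_F:=a_{i_1}+\dots+a_{i_m}$, and let $\mathrm{FS}(a_1,a_2,\dots)$ be the set of all such $a_F$. Write $F<G$ if every element of $F$ is smaller than every element of $G$. A sequence is \emph{bijective} if its terms are pairwise distinct, and \emph{proper} if $a_F\neq a_G$ for all nonempty finite index sets $F<G$. A \emph{sumsequence} of $a_1,a_2,\dots$ is a sequence $a_{F_1},a_{F_2},\dots$ with nonempty finite index sets $F_1<F_2<\cdots$. A \emph{proper IP set} in $S$ is a subset of $S$ that contains $\mathrm{FS}(a_1,a_2,\dots)$ for some bijective sequence $a_1,a_2,\dots$ in $S$. A family of sets is \emph{partition regular} if, for each finite partition of a set from the family, some part is also in the family. **Theorem.** The following assertions are equivalent for a semigroup $S$: 1. The family of proper IP sets in $S$ is partition regular. 2. Every bijective sequence in $S$ has a proper sumsequence. 3. The semigroup $S$ has no subsemigroup of any of the following types (in (b) and (c), up to isomorphism): (a) an infinite semigroup $S'$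 with $S'+S'$ finite; (b) the fan semilattice $(\mathbb N,\wedge)$, where $n\wedge n:=n$ and $m\wedge n:=1$ for distinct $m,n$; (c) the semigroup $(\mathbb N\times\mathbb N)\cup\{0\}$ in which every sum with a summand $0$ equals $0$, and $$(m_1,n_1)+(m_2,n_2):=\begin{cases}(m_1,n_1+n_2) & \text{if } m_1=m_2,\\ 0 & \text{otherwise.}\end{cases}$$ 4. For each bijective sequence $a_1,a_2,\dots$ in $S$ and each finite colouring of $S$, there is a bijective sumsequence $b_1,b_2,\dots$ of it such that the set $\mathrm{FS}(b_1,b_2,\dots)$ is monochromatic. 5. For each bijective sequence $a_1,a_2,\dots$ in $S$ and each finite colouring of $S$, there is a proper sumsequence $b_1,b_2,\dots$ of it such that the set $\mathrm{FS}(b_1,b_2,\dots)$ is monochromatic. -/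

import Mathlib

namespace SemigroupIP

section Sequences

/-- The sum `x₁ + (x₂ + (⋯ + xₘ))`, in this order, of a nonempty list. -/
def listSum {S : Type*} [AddSemigroup S] : (l : List S) → l ≠ [] → S
  | [x], _ => x
  | x :: y :: l, _ => x + listSum (y :: l) (List.cons_ne_nil y l)

/-- `a_F = a_{i₁} + ⋯ + a_{iₘ}` for a nonempty finite index set `F = {i₁ < ⋯ < iₘ}`. -/
def sumOver {S : Type*} [AddSemigroup S] (a : ℕ → S) (F : Finset ℕ) (hF : F.Nonempty) : S :=
  listSum ((F.sort (· ≤ ·)).map a) (by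
    intro h
    have h1 := congrArg List.length h
    rw [List.length_map, Finset.length_sort, List.length_nil] at h1
    exact hF.card_pos.ne' h1)

/-- `FS(a₁, a₂, …)`: the set of all finite sums `a_{i₁} + ⋯ + a_{iₘ}` with `m ≥ 1`
and `i₁ < ⋯ < iₘ`. -/
def FS {S : Type*} [AddSemigroup S] (a : ℕ → S) : Set S :=
  {s | ∃ (F : Finset ℕ) (hF : F.Nonempty), sumOver a F hF = s}

/-- `F < G`: all elements of `F` are smaller than all elements of `G`. -/
def Before (F G : Finset ℕ) : Prop := ∀ i ∈ F, ∀ j ∈ G, i < j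

/-- `b` is a sumsequence of `a`: `b = (a_{F₁}, a_{F₂}, …)` with `F₁ < F₂ < ⋯`. -/
def IsSumsequence {S : Type*} [AddSemigroup S] (b a : ℕ → S) : Prop :=
  ∃ (F : ℕ → Finset ℕ) (hF : ∀ n, (F n).Nonempty),
    (∀ m n, m < n → Before (F m) (F n)) ∧ ∀ n, b n = sumOver a (F n) (hF n)

/-- `a` is proper: `a_F ≠ a_G` for all (nonempty, finite) index sets `F < G`. -/
def IsProper {S : Type*} [AddSemigroup S] (a : ℕ → S) : Prop :=
  ∀ (F G : Finset ℕ) (hF : F.Nonempty) (hG : G.Nonempty), Before F G →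
    sumOver a F hF ≠ sumOver a G hG

/-- A proper IP set contains `FS(a₁, a₂, …)` for some sequence `a` of pairwise distinct
elements. -/
def IsProperIP {S : Type*} [AddSemigroup S] (A : Set S) : Prop :=
  ∃ a : ℕ → S, Function.Injective a ∧ FS a ⊆ A

end Sequences

/-- A family of sets is partition regular if, for each finite partition of a set from the family,
some part is in the family. -/
def PartitionRegular {S : Type*} (family : Set (Set S)) : Prop :=
  ∀ A ∈ family, ∀ P : Finpartition A, ∃ B ∈ P.parts, B ∈ family

/-- `A` is monochromatic for the colouring `c`. -/
def Monochromatic {S κ : Type*} (c : S → κ) (A : Set S) : Prop :=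
  ∃ i : κ, ∀ s ∈ A, c s = i

/-- The fan semilattice: the positive integers, with `m ∧ n = 1` for distinct `m`, `n`
and `n ∧ n = n`. The operation is written additively. -/
structure Fan where
  val : ℕ+

instance : AddSemigroup Fan where
  add x y := if x.val = y.val then x else ⟨1⟩
  add_assoc x y z := by
    obtain ⟨x⟩ := x
    obtain ⟨y⟩ := y
    obtain ⟨z⟩ := z
    simp only [HAdd.hAdd]
    grind

/-- The set `(ℕ × ℕ) ∪ {0}`, for `ℕ` the positive integers. -/
inductive FanOfRays where
  | zero : FanOfRays
  | pair (m n : ℕ+) : FanOfRays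

/-- `(m₁, n₁) + (m₂, n₂)` is `(m₁, n₁ + n₂)` if `m₁ = m₂`, and `0` otherwise; sums with a
summand `0` are `0`. -/
def FanOfRays.add : FanOfRays → FanOfRays → FanOfRays
  | .pair m₁ n₁, .pair m₂ n₂ => if m₁ = m₂ then .pair m₁ (n₁ + n₂) else .zero
  | .zero, _ => .zero
  | .pair _ _, .zero => .zero

instance : AddSemigroup FanOfRays where
  add := FanOfRays.add
  add_assoc x y z := by
    change FanOfRays.add (FanOfRays.add x y) z = FanOfRays.add x (FanOfRays.add y z)
    cases x <;> cases y <;> cases z <;> grind [FanOfRays.add, add_assoc]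

end SemigroupIP

namespace SemigroupIP

/-! ### Sums over finite index sets and sumsequences. -/

section SumOver

variable {S : Type*} [AddSemigroup S]

/-! The positive direction works in the semigroup of ultrafilters on `S`. Those containing the
finite sums of every tail of an injective `a` form a closed subsemigroup Γ with a nonprincipal
member. If Γ has a nonprincipal idempotent, the Galvin–Glazer recursion inside a colour class,
avoiding at each stage the finitely many sums with earlier indices, gives a proper monochromatic
sumsequence (`exists_proper_sumsequence`).

Otherwise, a minimal closed subsemigroup of Γ with a nonprincipal member has a nonprincipal member p
such that every U + p is principal, and compactness leaves only finitely many such sums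
(`IsLargeSubsemigroup.exists_principal_multiples`). So p + p, p + p + p, … are points `s 0`, `s 1`,
… of `S` with finitely many values. Generic elements for p either yield type (a) at once, or form a
sequence whose sums of two terms are `s 0` in increasing order and a constant `g` in decreasing
order (`hasForbiddenSubsemigroup_of_multiples`). If infinitely many terms have a multiple among `g`
and the `s k`, type (a) results; otherwise suitable multiples have a common absorbing mixed sum and
generate a fan or a fan of rays (`IsUniform.hasForbiddenSubsemigroup`).

Conversely, each forbidden semigroup carries a sequence whose distinct finite sums add into a finite
set (`SumsCollapse`); this refutes both partition regularity and the existence of proper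
sumsequences. -/

theorem Before.mono {F F' G G' : Finset ℕ} (h : Before F G) (hF : F' ⊆ F) (hG : G' ⊆ G) :
    Before F' G' :=
  fun i hi j hj => h i (hF hi) j (hG hj)

theorem sumOver_congr (a : ℕ → S) {F G : Finset ℕ} (h : F = G) (hF : F.Nonempty)
    (hG : G.Nonempty) : sumOver a F hF = sumOver a G hG := by
  subst h; rfl

theorem listSum_congr {l l' : List S} (h : l = l') (hl : l ≠ []) (hl' : l' ≠ []) :
    listSum l hl = listSum l' hl' := by
  subst h; rfl

theorem listSum_cons (x : S) (l : List S) (hl : l ≠ []) :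
    listSum (x :: l) (List.cons_ne_nil x l) = x + listSum l hl := by
  cases l with
  | nil => exact absurd rfl hl
  | cons y l => rfl

@[simp]
theorem sumOver_singleton (a : ℕ → S) (i : ℕ) (h : ({i} : Finset ℕ).Nonempty) :
    sumOver a {i} h = a i := by
  rw [sumOver, listSum_congr (l' := [a i]) (by simp) _ (by simp)]
  rfl

theorem sumOver_insert (a : ℕ → S) {i : ℕ} {F : Finset ℕ} (hi : ∀ j ∈ F, i < j)
    (hF : F.Nonempty) (h : (insert i F).Nonempty) :
    sumOver a (insert i F) h = a i + sumOver a F hF := by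
  have hs : (insert i F).sort (· ≤ ·) = i :: F.sort (· ≤ ·) :=
    Finset.sort_insert _ (fun j hj => (hi j hj).le) fun h => (hi i h).false
  unfold sumOver
  rw [listSum_congr (l' := a i :: (F.sort (· ≤ ·)).map a) (by simp [hs]) _ (by simp),
    listSum_cons]

/-- Induction on nonempty finite sets of natural numbers, adding a new minimum. -/
theorem nonempty_induction_on_min {p : ∀ F : Finset ℕ, F.Nonempty → Prop}
    (single : ∀ i, p {i} (Finset.singleton_nonempty i))
    (step : ∀ i F (hF : F.Nonempty), (∀ j ∈ F, i < j) → p F hF →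
      p (insert i F) (Finset.insert_nonempty i F))
    (F : Finset ℕ) (hF : F.Nonempty) : p F hF := by
  induction F using Finset.induction_on_min with
  | empty => exact absurd hF Finset.not_nonempty_empty
  | insert i F hi ih =>
    rcases F.eq_empty_or_nonempty with rfl | hne
    · exact single i
    · exact step i F hne hi (ih hne)

theorem sumOver_union (a : ℕ → S) {F G : Finset ℕ} (hF : F.Nonempty) (hG : G.Nonempty)
    (hFG : Before F G) (h : (F ∪ G).Nonempty) :
    sumOver a (F ∪ G) h = sumOver a F hF + sumOver a G hG := by
  revert hFG h
  induction F, hF using nonempty_induction_on_min with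
  | single i =>
    intro hFG h
    rw [sumOver_singleton, ← sumOver_insert a (fun j hj => hFG i (by simp) j hj) hG (by simp)]
    rfl
  | step i F hF hi ih =>
    intro hFG h
    have h' : (F ∪ G).Nonempty := hF.mono Finset.subset_union_left
    rw [sumOver_congr a (Finset.insert_union i F G) h (by simp),
      sumOver_insert a _ h', sumOver_insert a hi hF,
      ih (hFG.mono (Finset.subset_insert _ _) subset_rfl) h', add_assoc]
    intro j hj
    rcases Finset.mem_union.1 hj with hj | hj
    · exact hi j hj
    · exact hFG i (by simp) j hj

theorem biUnion_nonempty {G : Finset ℕ} (hG : G.Nonempty) {F : ℕ → Finset ℕ}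
    (hF : ∀ n, (F n).Nonempty) : (G.biUnion F).Nonempty :=
  hG.biUnion fun n _ => hF n

theorem before_biUnion {F : ℕ → Finset ℕ} (hlt : ∀ m n, m < n → Before (F m) (F n))
    {G H : Finset ℕ} (hGH : Before G H) : Before (G.biUnion F) (H.biUnion F) := by
  intro i hi j hj
  obtain ⟨m, hm, hi⟩ := Finset.mem_biUnion.1 hi
  obtain ⟨n, hn, hj⟩ := Finset.mem_biUnion.1 hj
  exact hlt m n (hGH m hm n hn) i hi j hj

theorem sumOver_blocks {a b : ℕ → S} {F : ℕ → Finset ℕ} (hF : ∀ n, (F n).Nonempty)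
    (hlt : ∀ m n, m < n → Before (F m) (F n)) (hb : ∀ n, b n = sumOver a (F n) (hF n))
    (G : Finset ℕ) (hG : G.Nonempty) :
    sumOver b G hG = sumOver a (G.biUnion F) (biUnion_nonempty hG hF) := by
  induction G, hG using nonempty_induction_on_min with
  | single i => rw [sumOver_singleton, hb,
      sumOver_congr a (Finset.singleton_biUnion (a := i) (t := F)).symm]
  | step i G hG hi ih =>
    rw [sumOver_insert b hi hG, ih, hb, ← sumOver_union a (hF i) (biUnion_nonempty hG hF)]
    · exact sumOver_congr a (by rw [Finset.biUnion_insert]) _ _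
    · simpa using before_biUnion hlt (G := {i}) (H := G)
        (fun _ h j hj => Finset.mem_singleton.1 h ▸ hi j hj)
    · exact (hF i).mono Finset.subset_union_left

theorem IsSumsequence.FS_subset {a b : ℕ → S} (h : IsSumsequence b a) : FS b ⊆ FS a := by
  obtain ⟨F, hF, hlt, hb⟩ := h
  rintro _ ⟨G, hG, rfl⟩
  exact ⟨_, _, (sumOver_blocks hF hlt hb G hG).symm⟩

theorem mem_FS (a : ℕ → S) (i : ℕ) : a i ∈ FS a :=
  ⟨{i}, Finset.singleton_nonempty i, sumOver_singleton a i _⟩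

theorem sumOver_pair (a : ℕ → S) {i j : ℕ} (hij : i < j) (h : ({i, j} : Finset ℕ).Nonempty) :
    sumOver a {i, j} h = a i + a j := by
  rw [sumOver_insert a (by simpa using hij) (Finset.singleton_nonempty j), sumOver_singleton]

theorem add_mem_FS (a : ℕ → S) {i j : ℕ} (hij : i < j) : a i + a j ∈ FS a :=
  ⟨{i, j}, by simp, sumOver_pair a hij _⟩

theorem IsProper.injective {a : ℕ → S} (h : IsProper a) : Function.Injective a := by
  refine Function.Injective.of_lt_imp_ne fun i j hij => ?_
  simpa using h {i} {j} (by simp) (by simp) (by simpa [Before] using hij)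

end SumOver

/-! ### Sequences whose finite sums collapse. -/

section FiniteSums

variable {S : Type*} [AddSemigroup S]

/-- Any two distinct finite sums of terms of `a` have their sum in the finite set `Z`. -/
structure SumsCollapse (a : ℕ → S) (Z : Set S) : Prop where
  injective : Function.Injective a
  finite : Z.Finite
  add_mem : ∀ x ∈ FS a, ∀ y ∈ FS a, x ≠ y → x + y ∈ Z

/-- Sums of consecutive disjoint pairs of a proper sumsequence would be infinitely many distinct
elements of `Z`. -/
theorem SumsCollapse.not_isProper {a b : ℕ → S} {Z : Set S} (h : SumsCollapse a Z)
    (hb : IsSumsequence b a) : ¬ IsProper b := by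
  intro hp
  have hmem : ∀ k, b (2 * k) + b (2 * k + 1) ∈ Z := fun k =>
    h.add_mem _ (hb.FS_subset (mem_FS b _)) _ (hb.FS_subset (mem_FS b _))
      (hp.injective.ne (by omega))
  have hinj : Function.Injective fun k => b (2 * k) + b (2 * k + 1) := by
    refine Function.Injective.of_lt_imp_ne fun i j hij => ?_
    have := hp {2 * i, 2 * i + 1} {2 * j, 2 * j + 1} (by simp) (by simp)
      (by simp only [Before, Finset.mem_insert, Finset.mem_singleton]; omega)
    rwa [sumOver_pair b (by omega), sumOver_pair b (by omega)] at this
  exact (Set.infinite_range_of_injective hinj)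
    (h.finite.subset (Set.range_subset_iff.2 hmem))

/-- Every set has a finite partition into parts of the form `A ∩ Z` and `A \ Z`. -/
theorem exists_finpartition_inter_diff {α : Type*} (A Z : Set α) :
    ∃ P : Finpartition A, ∀ B ∈ P.parts, B = A ∩ Z ∨ B = A \ Z := by
  classical
  refine ⟨(⊤ : Finpartition (A ∩ Z)).extendOfLE Set.inter_subset_left, fun B hB => ?_⟩
  rcases Finpartition.mem_parts_or_eq_sdiff_of_mem_extendOfLE _ _ hB with h | h
  · exact Or.inl (Finset.mem_singleton.1 (Finpartition.parts_top_subset _ h))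
  · exact Or.inr (by rw [h]; simp)

/-- Cut `FS a` along `Z`: the part inside is finite, and the part outside cannot contain both two
distinct finite sums and their sum. -/
theorem SumsCollapse.not_partitionRegular {a : ℕ → S} {Z : Set S} (h : SumsCollapse a Z) :
    ¬ PartitionRegular {A : Set S | IsProperIP A} := by
  intro hreg
  obtain ⟨P, hP⟩ := exists_finpartition_inter_diff (FS a) Z
  obtain ⟨B, hB, b, hinj, hb⟩ := hreg (FS a) ⟨a, h.injective, subset_rfl⟩ P
  have hsub : FS b ⊆ FS a := hb.trans (P.le hB)
  rcases hP B hB with rfl | rfl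
  · exact Set.infinite_range_of_injective hinj
      (h.finite.subset (Set.range_subset_iff.2 fun i => (hb (mem_FS b i)).2))
  · exact (hb (add_mem_FS b zero_lt_one)).2
      (h.add_mem _ (hsub (mem_FS b 0)) _ (hsub (mem_FS b 1)) (hinj.ne zero_ne_one))

/-- A set contains `FS a` if it contains the terms of `a` and is closed under adding them on the
left. -/
theorem FS_subset_of_add_mem {a : ℕ → S} {A : Set S} (ha : ∀ i, a i ∈ A)
    (hadd : ∀ i, ∀ x ∈ A, a i + x ∈ A) : FS a ⊆ A := by
  rintro _ ⟨F, hF, rfl⟩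
  induction F, hF using nonempty_induction_on_min with
  | single i => simpa using ha i
  | step i F hF hi ih => rw [sumOver_insert a hi hF]; exact hadd i _ ih

open scoped Pointwise in
theorem exists_sumsCollapse_of_finite_add {T : AddSubsemigroup S} (hT : (T : Set S).Infinite)
    (hfin : ((T : Set S) + (T : Set S)).Finite) : ∃ (a : ℕ → S) (Z : Set S), SumsCollapse a Z := by
  let a := hT.natEmbedding
  have hsub : FS (fun n => (a n : S)) ⊆ T :=
    FS_subset_of_add_mem (fun i => (a i).2) fun i x hx => T.add_mem (a i).2 hx
  exact ⟨fun n => (a n : S), _, Subtype.val_injective.comp a.injective, hfin,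
    fun x hx y hy _ => Set.add_mem_add (hsub hx) (hsub hy)⟩

/-- If the terms of `a` are distinct, and the sum of distinct terms is always `z`, with
`a i + z = z`, then every two distinct finite sums have the sum `z`. -/
theorem exists_sumsCollapse_of_add_eq {a : ℕ → S} (hinj : Function.Injective a) {z : S}
    (hz : ∀ i j, i ≠ j → a i + a j = z) (hl : ∀ i, a i + z = z) (hr : ∀ i, z + a i = z)  :
    ∃ (a : ℕ → S) (Z : Set S), SumsCollapse a Z := by
  have hzz : z + z = z := by rw [← hz 0 1 (by simp), ← add_assoc, hz 0 1 (by simp), hr, hr]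
  have hsub : ∀ x ∈ FS a, x ∈ Set.range a ∨ x = z := by
    suffices ∀ F hF, (∃ i ∈ F, a i = sumOver a F hF) ∨ sumOver a F hF = z by
      rintro _ ⟨F, hF, rfl⟩
      exact (this F hF).imp_left fun ⟨i, _, hi⟩ => ⟨i, hi⟩
    intro F hF
    induction F, hF using nonempty_induction_on_min with
    | single i => simp
    | step i F hF hi ih =>
      right
      rw [sumOver_insert a hi hF]
      rcases ih with ⟨j, hj, h⟩ | h
      · rw [← h, hz i j (hi j hj).ne]
      · rw [h, hl]
  refine ⟨a, {z}, hinj, Set.finite_singleton z, fun x hx y hy hxy => ?_⟩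
  rcases hsub x hx with ⟨i, rfl⟩ | rfl <;> rcases hsub y hy with ⟨j, rfl⟩ | rfl
  · exact hz i j fun h => hxy (h ▸ rfl)
  · exact hl i
  · exact hr j
  · exact hzz

end FiniteSums

/-! ### Collapse in the forbidden semigroups; partitions as colourings. -/

section Obstructions

variable {S : Type*} [AddSemigroup S]

theorem Fan.mk_add_mk (m n : ℕ+) : (⟨m⟩ : Fan) + ⟨n⟩ = if m = n then ⟨m⟩ else ⟨1⟩ := rfl

theorem FanOfRays.pair_add_pair (m₁ n₁ m₂ n₂ : ℕ+) :
    pair m₁ n₁ + pair m₂ n₂ = if m₁ = m₂ then pair m₁ (n₁ + n₂) else zero := rfl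

@[simp]
theorem FanOfRays.zero_add' (x : FanOfRays) : zero + x = zero := rfl

@[simp]
theorem FanOfRays.add_zero' (x : FanOfRays) : x + zero = zero := by
  cases x <;> rfl

theorem exists_sumsCollapse_of_fan {T : AddSubsemigroup S} (e : T ≃+ Fan) :
    ∃ (a : ℕ → S) (Z : Set S), SumsCollapse a Z := by
  -- The sequence starts at 2, because 1 is the absorbing element of the fan.
  have hne (n : ℕ) : (n + 1).succPNat ≠ 1 := fun h => by simpa using congrArg PNat.val h
  have key (x y z : Fan) (h : x + y = z) : (e.symm x : S) + e.symm y = e.symm z := by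
    rw [← h, map_add, AddMemClass.coe_add]
  refine exists_sumsCollapse_of_add_eq (a := fun n => (e.symm ⟨(n + 1).succPNat⟩ : T))
    (z := (e.symm ⟨1⟩ : T)) (fun m n h => ?_) (fun i j hij => key _ _ _ ?_)
    (fun i => key _ _ _ ?_) (fun i => key _ _ _ ?_)
  · have := e.symm.injective (Subtype.val_injective h)
    simpa using congrArg Fan.val this
  · rw [Fan.mk_add_mk, if_neg]
    simpa using hij
  · rw [Fan.mk_add_mk, if_neg (hne i)]
  · rw [Fan.mk_add_mk, if_neg (hne i).symm]

theorem exists_sumsCollapse_of_fanOfRays {T : AddSubsemigroup S} (e : T ≃+ FanOfRays) :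
    ∃ (a : ℕ → S) (Z : Set S), SumsCollapse a Z := by
  have key (x y z : FanOfRays) (h : x + y = z) : (e.symm x : S) + e.symm y = e.symm z := by
    rw [← h, map_add, AddMemClass.coe_add]
  refine exists_sumsCollapse_of_add_eq (a := fun n => (e.symm (.pair n.succPNat 1) : T))
    (z := (e.symm .zero : T)) (fun m n h => ?_) (fun i j hij => key _ _ _ ?_)
    (fun i => key _ _ _ ?_) (fun i => key _ _ _ ?_)
  · have := e.symm.injective (Subtype.val_injective h)
    simpa using this
  · rw [FanOfRays.pair_add_pair, if_neg]
    simpa using hij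
  · simp
  · simp

theorem partitionRegular_of_monochromatic
    (H : ∀ a : ℕ → S, Function.Injective a → ∀ (k : ℕ) (c : S → Fin k),
        ∃ b : ℕ → S, IsSumsequence b a ∧ Function.Injective b ∧ Monochromatic c (FS b)) :
    PartitionRegular {A : Set S | IsProperIP A} := by
  classical
  rintro A ⟨a, ha, hA⟩ P
  -- Colour by the part containing the element; `none` is the colour outside `A`.
  have hex : ∀ s, ∃ o : Option P.parts, s ∈ A → ∃ B, o = some B ∧ s ∈ (B : Set S) := by
    intro s
    by_cases hs : s ∈ A
    · have hs' := hs
      rw [← P.sup_parts, Finset.sup_id_set_eq_sUnion] at hs'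
      obtain ⟨B, hB, hsB⟩ := hs'
      exact ⟨some ⟨B, hB⟩, fun _ => ⟨⟨B, hB⟩, rfl, hsB⟩⟩
    · exact ⟨none, fun h => absurd h hs⟩
  choose f hf using hex
  obtain ⟨b, hb, hinj, i, hi⟩ :=
    H a ha _ fun s => Fintype.equivFin (Option P.parts) (f s)
  have hi' : ∀ s ∈ FS b, f s = f (b 0) := fun s hs =>
    (Fintype.equivFin (Option P.parts)).injective ((hi s hs).trans (hi _ (mem_FS b 0)).symm)
  have hsub : FS b ⊆ A := hb.FS_subset.trans hA
  obtain ⟨B, hB, -⟩ := hf _ (hsub (mem_FS b 0))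
  refine ⟨B, B.2, b, hinj, fun s hs => ?_⟩
  obtain ⟨B', hB', hs'⟩ := hf s (hsub hs)
  rw [hi' s hs, hB, Option.some_inj] at hB'
  rwa [hB']

end Obstructions

/-! ### Galvin–Glazer recursion along a nonprincipal idempotent. -/

section Construction

attribute [local instance] Ultrafilter.addSemigroup

variable {S : Type*} [AddSemigroup S]

/-- The ultrafilters on `S` that contain the finite sums of every tail of `a`. -/
def tailUltrafilters (a : ℕ → S) : Set (Ultrafilter S) :=
  {U | ∀ n : ℕ, ∀ᶠ x in (U : Filter S),
    ∃ (F : Finset ℕ) (hF : F.Nonempty), (∀ i ∈ F, n ≤ i) ∧ sumOver a F hF = x}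

theorem add_mem_tailUltrafilters {a : ℕ → S} {U V : Ultrafilter S}
    (hU : U ∈ tailUltrafilters a) (hV : V ∈ tailUltrafilters a) : U + V ∈ tailUltrafilters a := by
  intro n
  rw [Ultrafilter.eventually_add]
  filter_upwards [hU n]
  rintro _ ⟨F, hF, hnF, rfl⟩
  filter_upwards [hV (max n (F.max' hF + 1))]
  rintro _ ⟨G, hG, hnG, rfl⟩
  refine ⟨F ∪ G, hF.mono Finset.subset_union_left, fun i hi => ?_,
    sumOver_union a hF hG (fun i hi j hj => ?_) _⟩
  · rcases Finset.mem_union.1 hi with hi | hi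
    · exact hnF i hi
    · exact (le_max_left _ _).trans (hnG i hi)
  · exact (Nat.lt_succ_of_le (F.le_max' i hi)).trans_le ((le_max_right _ _).trans (hnG j hj))

theorem isClosed_tailUltrafilters (a : ℕ → S) : IsClosed (tailUltrafilters a) := by
  simp only [tailUltrafilters, Set.ofPred_forall]
  exact isClosed_iInter fun n => ultrafilter_isClosed_basic _

theorem map_hyperfilter_mem_tailUltrafilters (a : ℕ → S) :
    (Filter.hyperfilter ℕ).map a ∈ tailUltrafilters a := by
  intro n
  rw [Ultrafilter.coe_map, Filter.eventually_map]
  have : ∀ᶠ m in (Filter.hyperfilter ℕ : Filter ℕ), n ≤ m :=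
    Nat.hyperfilter_le_atTop (Filter.eventually_ge_atTop n)
  filter_upwards [this] with m hm
  exact ⟨{m}, Finset.singleton_nonempty m, by simpa using hm, sumOver_singleton a m _⟩

/-- An ultrafilter is nonprincipal. -/
def Nonprincipal {α : Type*} (U : Ultrafilter α) : Prop := ∀ x, U ≠ pure x

theorem Nonprincipal.eventually_notMem {α : Type*} {U : Ultrafilter α} (hU : Nonprincipal U)
    {s : Set α} (hs : s.Finite) : ∀ᶠ x in (U : Filter α), x ∉ s := by
  rw [Ultrafilter.eventually_not]
  intro h
  obtain ⟨x, -, hx⟩ := Ultrafilter.eq_pure_of_finite_mem hs h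
  exact hU x hx

theorem Nonprincipal.infinite {α : Type*} {U : Ultrafilter α} (hU : Nonprincipal U)
    {s : Set α} (hs : ∀ᶠ x in (U : Filter α), x ∈ s) : s.Infinite := fun h =>
  let ⟨_, hx, hx'⟩ := (hs.and (hU.eventually_notMem h)).exists
  hx' hx

theorem nonprincipal_map_hyperfilter {α : Type*} {a : ℕ → α} (ha : Function.Injective a) :
    Nonprincipal ((Filter.hyperfilter ℕ).map a) := by
  intro x hx
  have h : ∀ᶠ y in ((Filter.hyperfilter ℕ).map a : Filter α), y = x := by
    rw [hx]; simp
  rw [Ultrafilter.coe_map, Filter.eventually_map] at h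
  refine Filter.notMem_hyperfilter_of_finite (s := {m | a m = x}) ?_ h
  exact (Set.finite_singleton x).preimage ha.injOn

/-- The elements `x` of `A` with `x + y ∈ A` for `U`-most `y`. -/
def starSet (U : Ultrafilter S) (A : Set S) : Set S :=
  {x ∈ A | ∀ᶠ y in (U : Filter S), x + y ∈ A}

theorem starSet_mem {U : Ultrafilter S} (hU : U + U = U) {A : Set S} (hA : A ∈ U) :
    starSet U A ∈ U := by
  have : ∀ᶠ x in ((U + U : Ultrafilter S) : Filter S), x ∈ A := by rw [hU]; exact hA
  rw [Ultrafilter.eventually_add] at this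
  exact Filter.inter_mem hA this

/-- Idempotence applied to a translate of `A` shows that the star set reproduces itself, which is
what lets the recursion continue. -/
theorem eventually_add_mem_starSet {U : Ultrafilter S} (hU : U + U = U) {A : Set S} {x : S}
    (hx : x ∈ starSet U A) : ∀ᶠ y in (U : Filter S), x + y ∈ starSet U A := by
  have h : ∀ᶠ y in ((U + U : Ultrafilter S) : Filter S), x + y ∈ A := by rw [hU]; exact hx.2
  rw [Ultrafilter.eventually_add] at h
  filter_upwards [hx.2, h] with y hy hy'
  exact ⟨hy, by simpa only [add_assoc] using hy'⟩

/-- A stage in the choice of a sumsequence: a bound for the indices used so far, and a large set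
to which all later sums have to belong. -/
structure Stage (U : Ultrafilter S) where
  bound : ℕ
  target : Set S
  target_mem : target ∈ U
  eventually_add : ∀ x ∈ target, ∀ᶠ y in (U : Filter S), x + y ∈ target

/-- The nonempty sums of terms of `a` with indices below `n`. -/
def sumsBelow (a : ℕ → S) (n : ℕ) : Set S :=
  {x | ∃ (F : Finset ℕ) (hF : F.Nonempty), (∀ i ∈ F, i < n) ∧ sumOver a F hF = x}

theorem finite_sumsBelow (a : ℕ → S) (n : ℕ) : (sumsBelow a n).Finite := by
  have : Finite {F : Finset ℕ // F ∈ (Finset.range n).powerset ∧ F.Nonempty} :=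
    ((Finset.range n).powerset.finite_toSet.subset fun F hF => hF.1).to_subtype
  refine (Set.finite_range fun F : {F : Finset ℕ // F ∈ (Finset.range n).powerset ∧ F.Nonempty} =>
    sumOver a F.1 F.2.2).subset ?_
  rintro x ⟨F, hF, hlt, rfl⟩
  exact ⟨⟨F, Finset.mem_powerset.2 fun i hi => Finset.mem_range.2 (hlt i hi), hF⟩, rfl⟩

/-- Nonprincipality allows discarding the finitely many sums with indices below the new bound; this
is the source of properness. Taking the star set restores the translation property. -/
theorem Stage.exists_next {a : ℕ → S} {U : Ultrafilter S} (hU : U ∈ tailUltrafilters a)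
    (hid : U + U = U) (hnp : Nonprincipal U) (σ : Stage U) :
    ∃ (τ : Stage U) (F : Finset ℕ) (hF : F.Nonempty), (∀ i ∈ F, σ.bound ≤ i ∧ i < τ.bound) ∧
      sumOver a F hF ∈ σ.target ∧ τ.target ⊆ σ.target ∧
      (∀ y ∈ τ.target, sumOver a F hF + y ∈ σ.target) ∧
      Disjoint τ.target (sumsBelow a τ.bound) := by
  obtain ⟨_, hx, F, hF, hle, rfl⟩ :=
    ((show ∀ᶠ x in (U : Filter S), x ∈ σ.target from σ.target_mem).and (hU σ.bound)).exists
  set n := F.max' hF + 1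
  set A : Set S := {y | (y ∈ σ.target ∧ sumOver a F hF + y ∈ σ.target) ∧ y ∉ sumsBelow a n}
  have hA : A ∈ U := (Filter.Eventually.and σ.target_mem (σ.eventually_add _ hx)).and
    (hnp.eventually_notMem (finite_sumsBelow a n))
  refine ⟨⟨n, starSet U A, starSet_mem hid hA, fun x hx => eventually_add_mem_starSet hid hx⟩,
    F, hF, fun i hi => ⟨hle i hi, Nat.lt_succ_of_le (F.le_max' i hi)⟩, hx, fun y hy => hy.1.1.1,
    fun y hy => hy.1.1.2, Set.disjoint_left.2 fun y hy => hy.1.2⟩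

/-- An idempotent nonprincipal ultrafilter yields proper sumsequences with all finite sums in a
given large set. -/
theorem exists_proper_sumsequence {a : ℕ → S} {U : Ultrafilter S} (hU : U ∈ tailUltrafilters a)
    (hid : U + U = U) (hnp : Nonprincipal U) {A : Set S} (hA : A ∈ U) :
    ∃ b : ℕ → S, IsSumsequence b a ∧ IsProper b ∧ FS b ⊆ A := by
  choose next F hF hbd hmem hsub hadd hdisj using Stage.exists_next hU hid hnp
  let σ₀ : Stage U :=
    ⟨0, starSet U A, starSet_mem hid hA, fun x hx => eventually_add_mem_starSet hid hx⟩
  let σ : ℕ → Stage U := fun n => next^[n] σ₀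
  have hσ (n : ℕ) : σ (n + 1) = next (σ n) := Function.iterate_succ_apply' _ _ _
  have hanti : Antitone fun n => (σ n).target :=
    antitone_nat_of_succ_le fun n => by rw [hσ]; exact hsub _
  have hbound : Monotone fun n => (σ n).bound := monotone_nat_of_le_succ fun n => by
    rw [hσ]
    obtain ⟨i, hi⟩ := hF (σ n)
    exact (hbd _ i hi).1.trans (hbd _ i hi).2.le
  have hlt : ∀ m n, m < n → Before (F (σ m)) (F (σ n)) := fun m n hmn i hi j hj => by
    refine (hbd _ i hi).2.trans_le (le_trans ?_ (hbd _ j hj).1)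
    rw [← hσ]
    exact hbound hmn
  let b : ℕ → S := fun n => sumOver a (F (σ n)) (hF (σ n))
  -- Tracking the stage `k` lets the induction on the minimum work: the later summands lie in the
  -- next target, whose translate by the first summand stays in the current one.
  have hb (G : Finset ℕ) (hG : G.Nonempty) : ∀ k, (∀ i ∈ G, k ≤ i) →
      sumOver b G hG ∈ (σ k).target := by
    induction G, hG using nonempty_induction_on_min with
    | single i =>
      intro k hk
      rw [sumOver_singleton]
      exact hanti (hk i (by simp)) (hmem _)
    | step i G hG hi ih =>
      intro k hk
      rw [sumOver_insert b hi hG]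
      refine hanti (hk i (by simp)) (hadd _ _ ?_)
      rw [← hσ]
      exact ih (i + 1) hi
  refine ⟨b, ⟨fun n => F (σ n), fun n => hF _, hlt, fun n => rfl⟩, fun G H hG hH hGH heq => ?_, ?_⟩
  · have hbelow : sumOver b G hG ∈ sumsBelow a (next (σ (G.max' hG))).bound := by
      refine ⟨_, _, fun i hi => ?_, (sumOver_blocks (fun n => hF (σ n)) hlt (fun n => rfl) G hG).symm⟩
      obtain ⟨n, hn, hi⟩ := Finset.mem_biUnion.1 hi
      refine (hbd _ i hi).2.trans_le ?_
      rw [← hσ, ← hσ]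
      exact hbound (Nat.succ_le_succ (G.le_max' n hn))
    refine Set.disjoint_left.1 (hdisj (σ (G.max' hG))) ?_ hbelow
    rw [heq, ← hσ]
    exact hb H hH _ fun j hj => hGH _ (G.max'_mem hG) j hj
  · rintro _ ⟨G, hG, rfl⟩
    exact (hb G hG 0 fun _ _ => Nat.zero_le _).1

end Construction

/-! ### Minimal closed subsemigroups with a nonprincipal member. -/

section ClosedSubsemigroups

attribute [local instance] Ultrafilter.addSemigroup

theorem eq_pure_iff {α : Type*} {U : Ultrafilter α} {z : α} :
    U = pure z ↔ ∀ᶠ x in (U : Filter α), x = z := by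
  constructor
  · rintro rfl
    simp
  · intro h
    obtain ⟨x, hx, hU⟩ := Ultrafilter.eq_pure_of_finite_mem (Set.finite_singleton z) h
    rwa [Set.mem_singleton_iff.1 hx] at hU

theorem not_nonprincipal {α : Type*} {U : Ultrafilter α} :
    ¬ Nonprincipal U ↔ ∃ x, U = pure x := by
  simp [Nonprincipal]

/-- Principal ultrafilters are isolated points. -/
theorem isOpen_of_principal {α : Type*} {W : Set (Ultrafilter α)}
    (h : ∀ U ∈ W, ¬ Nonprincipal U) : IsOpen W := by
  refine isOpen_iff_forall_mem_open.2 fun U hU => ?_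
  obtain ⟨x, rfl⟩ := not_nonprincipal.1 (h U hU)
  refine ⟨{V | {x} ∈ V}, fun V hV => ?_, ultrafilter_isOpen_basic _, ?_⟩
  · rwa [eq_pure_iff.2 hV]
  · exact Ultrafilter.mem_pure.2 rfl

theorem isClosed_nonprincipal (α : Type*) : IsClosed {U : Ultrafilter α | Nonprincipal U} :=
  isOpen_compl_iff.1 (isOpen_of_principal fun _ hU => hU)

variable {S : Type*} [AddSemigroup S]

theorem pure_add_pure (x y : S) : (pure x + pure y : Ultrafilter S) = pure (x + y) := by
  rw [eq_pure_iff, Ultrafilter.eventually_add]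
  simp

theorem add_pure_eq_pure_iff {U : Ultrafilter S} {x z : S} :
    U + pure x = pure z ↔ ∀ᶠ y in (U : Filter S), y + x = z := by
  rw [eq_pure_iff, Ultrafilter.eventually_add]
  simp

theorem pure_add_eq_pure_iff {U : Ultrafilter S} {x z : S} :
    pure x + U = pure z ↔ ∀ᶠ y in (U : Filter S), x + y = z := by
  rw [eq_pure_iff, Ultrafilter.eventually_add]
  simp

theorem add_eq_pure_iff {U V : Ultrafilter S} {z : S} :
    U + V = pure z ↔ ∀ᶠ x in (U : Filter S), ∀ᶠ y in (V : Filter S), x + y = z := by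
  rw [eq_pure_iff, Ultrafilter.eventually_add]

/-- A closed subsemigroup of the semigroup of ultrafilters that contains a nonprincipal
ultrafilter. -/
structure IsLargeSubsemigroup (M : Set (Ultrafilter S)) : Prop where
  isClosed : IsClosed M
  add_mem : ∀ U ∈ M, ∀ V ∈ M, U + V ∈ M
  exists_nonprincipal : ∃ U ∈ M, Nonprincipal U

/-- Zorn's lemma applies because the nonprincipal ultrafilters form a compact set, so a chain keeps
a common nonprincipal member. -/
theorem IsLargeSubsemigroup.exists_minimal {Γ : Set (Ultrafilter S)}
    (hΓ : IsLargeSubsemigroup Γ) :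
    ∃ M ⊆ Γ, Minimal (fun M => IsLargeSubsemigroup M) M := by
  refine zorn_superset_nonempty {M | IsLargeSubsemigroup M} (fun c hc hchain hne => ?_) Γ hΓ
  refine ⟨⋂₀ c, ⟨isClosed_sInter fun M hM => (hc hM).isClosed,
    fun U hU V hV M hM => (hc hM).add_mem U (hU M hM) V (hV M hM), ?_⟩,
    fun M hM => Set.sInter_subset_of_mem hM⟩
  have : Nonempty c := hne.to_subtype
  have hcl (M : c) : IsClosed ((M : Set (Ultrafilter S)) ∩ {U | Nonprincipal U}) :=
    (hc M.2).isClosed.inter (isClosed_nonprincipal S)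
  have hdir : Directed (· ⊇ ·)
      fun M : c => (M : Set (Ultrafilter S)) ∩ {U | Nonprincipal U} := by
    intro M N
    rcases hchain.total M.2 N.2 with h | h
    · exact ⟨M, subset_rfl, Set.inter_subset_inter_left _ h⟩
    · exact ⟨N, Set.inter_subset_inter_left _ h, subset_rfl⟩
  obtain ⟨U, hU⟩ := IsCompact.nonempty_iInter_of_directed_nonempty_isCompact_isClosed
    (fun M : c => (M : Set (Ultrafilter S)) ∩ {U | Nonprincipal U}) hdir
    (fun M => (hc M.2).exists_nonprincipal) (fun M => (hcl M).isCompact) hcl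
  rw [Set.mem_iInter] at hU
  exact ⟨U, fun M hM => (hU ⟨M, hM⟩).1, (hU ⟨_, hne.some_mem⟩).2⟩

/-- An ultrafilter with a left identity that has a one-sided inverse with principal products in
both orders is principal. -/
theorem not_nonprincipal_of_inverse {p v : Ultrafilter S} {e f : S} (hpe : p + pure e = p)
    (hfp : pure f + p = p) (hee : e + e = e)
    (hff : f + f = f) (hpv : p + v = pure f) (hvp : v + p = pure e) : ¬ Nonprincipal p := by
  intro hp
  have h₁ : ∀ᶠ x in (p : Filter S), x + e = x := by
    rw [← hpe, Ultrafilter.eventually_add]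
    simp [add_assoc, hee]
  have h₂ : ∀ᶠ x in (p : Filter S), f + x = x := by
    rw [← hfp, Ultrafilter.eventually_add]
    simp [← add_assoc, hff]
  rw [add_eq_pure_iff] at hpv hvp
  obtain ⟨x₁, hx₁, hpv⟩ := (h₁.and hpv).exists
  obtain ⟨y₁, hxy, hvp⟩ := (hpv.and hvp).exists
  -- For p-most x, x = f + x = x₁ + y₁ + x = x₁ + e = x₁.
  refine hp x₁ (eq_pure_iff.2 ?_)
  filter_upwards [hvp, h₂] with x hyx hx
  rw [← hx, ← hxy, add_assoc, hyx, hx₁]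

/-- Otherwise M + p = M for each nonprincipal p in M, by minimality. The x with M + x = M then form
a large subsemigroup, closed because only principal x are removed, so all of M qualifies. Hence u +
x = y is always solvable and idempotents are right identities. A nonprincipal p then has an inverse
v with v + p and p + v idempotent, hence principal, contradicting `not_nonprincipal_of_inverse`. -/
theorem IsLargeSubsemigroup.exists_principal_add {M : Set (Ultrafilter S)}
    (hM : Minimal (fun M => IsLargeSubsemigroup M) M)
    (hid : ∀ U ∈ M, U + U = U → ¬ Nonprincipal U) :
    ∃ p ∈ M, Nonprincipal p ∧ ∀ U ∈ M, ¬ Nonprincipal (U + p) := by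
  by_contra! hcon
  have himage (p) (hp : p ∈ M) (h : ∃ U ∈ M, Nonprincipal (U + p)) : (· + p) '' M = M := by
    refine hM.eq_of_subset ⟨?_, ?_, ?_⟩ ?_
    · exact (Ultrafilter.continuous_add_left p).isClosedMap _ hM.prop.isClosed
    · rintro _ ⟨U, hU, rfl⟩ _ ⟨V, hV, rfl⟩
      exact ⟨U + p + V, hM.prop.add_mem _ (hM.prop.add_mem U hU p hp) V hV, add_assoc _ _ _⟩
    · obtain ⟨U, hU, h⟩ := h
      exact ⟨_, ⟨U, hU, rfl⟩, h⟩
    · rintro _ ⟨U, hU, rfl⟩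
      exact hM.prop.add_mem U hU p hp
  have hW : {x ∈ M | (· + x) '' M = M} = M := by
    refine hM.eq_of_subset ⟨?_, ?_, ?_⟩ (Set.sep_subset _ _)
    · have : {x ∈ M | (· + x) '' M = M} = M \ {x ∈ M | (· + x) '' M ≠ M} := by
        ext x; by_cases h : (· + x) '' M = M <;> simp [h]
      rw [this]
      refine hM.prop.isClosed.sdiff (isOpen_of_principal fun p hp hnp => hp.2 ?_)
      exact himage p hp.1 (hcon p hp.1 hnp)
    · rintro x ⟨hx, hx'⟩ y ⟨hy, hy'⟩
      refine ⟨hM.prop.add_mem x hx y hy, ?_⟩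
      calc (· + (x + y)) '' M = (· + y) '' ((· + x) '' M) := by
            rw [Set.image_image]; simp only [add_assoc]
        _ = M := by rw [hx', hy']
    · obtain ⟨p, hp, hnp⟩ := hM.prop.exists_nonprincipal
      exact ⟨p, ⟨hp, himage p hp (hcon p hp hnp)⟩, hnp⟩
  have hsurj {x y} (hx : x ∈ M) (hy : y ∈ M) : ∃ u ∈ M, u + x = y := by
    rw [← hW] at hx
    rw [← hx.2] at hy
    exact hy
  have hright {e x} (he : e ∈ M) (hee : e + e = e) (hx : x ∈ M) : x + e = x := by
    obtain ⟨u, -, rfl⟩ := hsurj he hx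
    rw [add_assoc, hee]
  obtain ⟨p, hp, hnp⟩ := hM.prop.exists_nonprincipal
  obtain ⟨e, ⟨he, hep⟩, hee⟩ := exists_idempotent_in_compact_add_subsemigroup
    Ultrafilter.continuous_add_left {x ∈ M | x + p = p} (hsurj hp hp)
    (hM.prop.isClosed.inter
      (isClosed_singleton.preimage (Ultrafilter.continuous_add_left p))).isCompact
    (fun x hx y hy => ⟨hM.prop.add_mem x hx.1 y hy.1, by rw [add_assoc, hy.2, hx.2]⟩)
  obtain ⟨u, hu, hup⟩ := hsurj hp he
  have hv : e + u ∈ M := hM.prop.add_mem e he u hu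
  have hvp : (e + u) + p = e := by rw [add_assoc, hup, hee]
  have hf : p + (e + u) ∈ M := hM.prop.add_mem p hp _ hv
  have hff : (p + (e + u)) + (p + (e + u)) = p + (e + u) := by
    rw [add_assoc, ← add_assoc (e + u), hvp, ← add_assoc e, hee]
  have hee' := hee
  obtain ⟨e', rfl⟩ := not_nonprincipal.1 (hid e he hee)
  obtain ⟨f', hf'⟩ := not_nonprincipal.1 (hid _ hf hff)
  rw [hf', pure_add_pure] at hff
  rw [pure_add_pure] at hee'
  refine not_nonprincipal_of_inverse (hright he hee hp) ?_ (Ultrafilter.pure_injective hee')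
    (Ultrafilter.pure_injective hff) hf' hvp hnp
  rw [← hf', add_assoc, hvp, hright he hee hp]

/-- If every idempotent ultrafilter in a large closed subsemigroup is principal, then this
subsemigroup has a nonprincipal member all of whose proper multiples are principal, and there are
only finitely many of these. -/
theorem IsLargeSubsemigroup.exists_principal_multiples {Γ : Set (Ultrafilter S)}
    (hΓ : IsLargeSubsemigroup Γ) (hid : ∀ U ∈ Γ, U + U = U → ¬ Nonprincipal U) :
    ∃ p : Ultrafilter S, Nonprincipal p ∧ ∃ s : ℕ → S, (Set.range s).Finite ∧
      p + p = pure (s 0) ∧ ∀ k, p + pure (s k) = pure (s (k + 1)) := by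
  obtain ⟨M, hMΓ, hM⟩ := hΓ.exists_minimal
  obtain ⟨p, hp, hnp, hprin⟩ := exists_principal_add hM fun U hU => hid U (hMΓ hU)
  -- A compact set of isolated points is finite.
  have hfin : ((· + p) '' M).Finite := by
    have hcomp : IsCompact ((· + p) '' M) :=
      hM.prop.isClosed.isCompact.image (Ultrafilter.continuous_add_left p)
    obtain ⟨t, -, ht⟩ := hcomp.elim_nhds_subcover (fun U => {U}) (by
      rintro _ ⟨U, hU, rfl⟩
      refine IsOpen.mem_nhds (isOpen_of_principal ?_) rfl
      rintro _ rfl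
      exact hprin U hU)
    exact (t.finite_toSet).subset (by simpa using ht)
  -- `P k` is the sum of `k + 2` copies of `p`.
  let P : ℕ → Ultrafilter S := fun k => (p + ·)^[k] (p + p)
  have hP (k : ℕ) : P (k + 1) = p + P k := Function.iterate_succ_apply' _ _ _
  have hPmem (k : ℕ) : P k ∈ (· + p) '' M := by
    induction k with
    | zero => exact ⟨p, hp, rfl⟩
    | succ k ih =>
      obtain ⟨U, hU, h⟩ := ih
      exact ⟨p + U, hM.prop.add_mem p hp U hU, by rw [hP, ← h]; exact add_assoc _ _ _⟩
  have hpure (k : ℕ) : ∃ x, P k = pure x := by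
    obtain ⟨U, hU, h⟩ := hPmem k
    rw [← h]
    exact not_nonprincipal.1 (hprin U hU)
  choose s hs using hpure
  refine ⟨p, hnp, s, ?_, hs 0, fun k => by rw [← hs, ← hs, hP]⟩
  refine (hfin.preimage Ultrafilter.pure_injective.injOn).subset ?_
  rintro _ ⟨k, rfl⟩
  rw [Set.mem_preimage, ← hs]
  exact hPmem k

end ClosedSubsemigroups

/-! ### Multiples of an element. -/

section Multiples

variable {S : Type*} [AddSemigroup S]

/-- The sum of `k + 1` copies of `x`. -/
def multiple (x : S) : ℕ → S
  | 0 => x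
  | k + 1 => multiple x k + x

@[simp]
theorem multiple_zero (x : S) : multiple x 0 = x := rfl

theorem multiple_succ (x : S) (k : ℕ) : multiple x (k + 1) = multiple x k + x := rfl

theorem multiple_add_multiple (x : S) (k l : ℕ) :
    multiple x k + multiple x l = multiple x (k + l + 1) := by
  induction l with
  | zero => rfl
  | succ l ih => rw [multiple_succ, ← add_assoc, ih]; rfl

theorem multiple_succ' (x : S) (k : ℕ) : multiple x (k + 1) = x + multiple x k := by
  have := multiple_add_multiple x 0 k
  rw [multiple_zero, zero_add] at this
  exact this.symm

theorem exists_multiple_multiple (x : S) (k l : ℕ) :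
    ∃ n, multiple (multiple x k) l = multiple x n := by
  induction l with
  | zero => exact ⟨k, rfl⟩
  | succ l ih =>
    obtain ⟨n, hn⟩ := ih
    exact ⟨n + k + 1, by rw [multiple_succ, hn, multiple_add_multiple]⟩

theorem exists_idempotent_multiple {x : S} (h : ¬ Function.Injective (multiple x)) :
    ∃ m, multiple x m + multiple x m = multiple x m := by
  obtain ⟨k, l, hkl, heq⟩ : ∃ k l, k < l ∧ multiple x k = multiple x l := by
    by_contra! hcon
    exact h (Function.Injective.of_lt_imp_ne hcon)
  obtain ⟨d, rfl⟩ : ∃ d, l = k + (d + 1) := ⟨l - k - 1, by omega⟩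
  have hper : ∀ j, multiple x (k + j + (d + 1)) = multiple x (k + j) := by
    intro j
    cases j with
    | zero => exact heq.symm
    | succ j =>
      have h₁ := multiple_add_multiple x k j
      have h₂ := multiple_add_multiple x (k + (d + 1)) j
      rw [← heq, h₁] at h₂
      rw [show k + (j + 1) + (d + 1) = k + (d + 1) + j + 1 by ring, ← h₂]
      rfl
  have hper' : ∀ n j, multiple x (k + j + n * (d + 1)) = multiple x (k + j) := by
    intro n
    induction n with
    | zero => simp
    | succ n ih =>
      intro j
      rw [← ih j, add_assoc k j (n * (d + 1)), ← hper]
      congr 1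
      ring
  -- For this index m, the number m + 1 = (k + 1)(d + 1) is a multiple of the period and m ≥ k, so
  -- doubling changes nothing.
  refine ⟨k + (k * d + d), ?_⟩
  rw [multiple_add_multiple, ← hper' (k + 1)]
  congr 1
  ring

theorem exists_addSubsemigroup_addEquiv {A : Type*} [AddSemigroup A] (f : A →ₙ+ S)
    (hf : Function.Injective f) : ∃ T : AddSubsemigroup S, Nonempty (T ≃+ A) :=
  ⟨AddHom.srange f, ⟨(AddEquiv.ofBijective f.srangeRestrict
    ⟨fun _ _ h => hf (congrArg Subtype.val h), f.srangeRestrict_surjective⟩).symm⟩⟩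

open scoped Pointwise in
theorem exists_addSubsemigroup_finite_add {X F : Set S} (hX : X.Infinite) (hF : F.Finite)
    (hXX : ∀ x ∈ X, ∀ y ∈ X, x + y ∈ F) (hXF : ∀ x ∈ X, ∀ y ∈ F, x + y ∈ F)
    (hFX : ∀ x ∈ F, ∀ y ∈ X, x + y ∈ F) (hFF : ∀ x ∈ F, ∀ y ∈ F, x + y ∈ F) :
    ∃ T : AddSubsemigroup S, (T : Set S).Infinite ∧ ((T : Set S) + (T : Set S)).Finite := by
  have h {x y} (hx : x ∈ X ∪ F) (hy : y ∈ X ∪ F) : x + y ∈ F := by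
    rcases hx with hx | hx <;> rcases hy with hy | hy
    exacts [hXX x hx y hy, hXF x hx y hy, hFX x hx y hy, hFF x hx y hy]
  refine ⟨⟨X ∪ F, fun hx hy => Or.inr (h hx hy)⟩, hX.mono Set.subset_union_left, ?_⟩
  refine hF.subset ?_
  rintro _ ⟨x, hx, y, hy, rfl⟩
  exact h hx hy

end Multiples

/-! ### Recognizing fans and fans of rays. -/

section Rays

variable {S : Type*} [AddSemigroup S]

theorem exists_fan {x : ℕ → S} (hx : Function.Injective x) {e : S}
    (hid : ∀ i, x i + x i = x i) (hadd : ∀ i j, i ≠ j → x i + x j = e) (hne : ∀ i, x i ≠ e) :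
    ∃ T : AddSubsemigroup S, Nonempty (T ≃+ Fan) := by
  have hl (i : ℕ) : x i + e = e := by
    rw [← hadd i (i + 1) (by simp), ← add_assoc, hid]
  have hr (i : ℕ) : e + x i = e := by
    rw [← hadd (i + 1) i (by simp), add_assoc, hid]
  have hee : e + e = e := by
    conv_lhs => rw [← hadd 0 1 (by simp)]
    rw [add_assoc, hadd 0 1 (by simp), hl, hl]
  let f : Fan → S := fun n => if n.val = 1 then e else x n.val.natPred
  have hf (m n : Fan) : f (m + n) = f m + f n := by
    obtain ⟨m⟩ := m
    obtain ⟨n⟩ := n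
    rw [Fan.mk_add_mk]
    by_cases hmn : m = n
    · subst hmn
      by_cases hm : m = 1 <;> simp [f, hm, hee, hid]
    · have := hadd m.natPred n.natPred (by rwa [Ne, PNat.natPred_inj])
      by_cases hm : m = 1 <;> by_cases hn : n = 1 <;> simp [f, hm, hn, hmn, hl, hr, hee, this]
  refine exists_addSubsemigroup_addEquiv ⟨f, hf⟩ ?_
  rintro ⟨m⟩ ⟨n⟩ h
  change f _ = f _ at h
  by_cases hm : m = 1 <;> by_cases hn : n = 1 <;> simp only [f, hm, hn, if_true, if_false] at h
  · rw [hm, hn]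
  · exact absurd h.symm (hne _)
  · exact absurd h (hne _)
  · rw [PNat.natPred_inj.1 (hx h)]

theorem exists_fanOfRays {x : ℕ → ℕ → S} (hx : ∀ i j k l, x i k = x j l → i = j ∧ k = l) {e : S}
    (hmul : ∀ i k l, x i k + x i l = x i (k + l + 1))
    (hadd : ∀ i j k l, i ≠ j → x i k + x j l = e) (hl : ∀ i k, x i k + e = e)
    (hr : ∀ i k, e + x i k = e) (hne : ∀ i k, x i k ≠ e) :
    ∃ T : AddSubsemigroup S, Nonempty (T ≃+ FanOfRays) := by
  have hee : e + e = e := by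
    conv_lhs => rw [← hadd 0 1 0 0 (by simp)]
    rw [add_assoc, hadd 0 1 0 0 (by simp), hl, hl]
  let f : FanOfRays → S
    | .zero => e
    | .pair m n => x m.natPred n.natPred
  have hf (a b : FanOfRays) : f (a + b) = f a + f b := by
    rcases a with _ | ⟨m, n⟩ <;> rcases b with _ | ⟨m', n'⟩
    · exact hee.symm
    · exact (hr _ _).symm
    · exact (hl _ _).symm
    · rw [FanOfRays.pair_add_pair]
      by_cases h : m = m'
      · subst h
        rw [if_pos rfl]
        change x _ _ = x _ _ + x _ _
        rw [hmul]
        congr 1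
        have h₁ := n.pos
        have h₂ := n'.pos
        simp only [PNat.natPred, PNat.add_coe]
        omega
      · rw [if_neg h]
        exact (hadd _ _ _ _ (by rwa [Ne, PNat.natPred_inj])).symm
  refine exists_addSubsemigroup_addEquiv ⟨f, hf⟩ ?_
  rintro (_ | ⟨m, n⟩) (_ | ⟨m', n'⟩) h
  · rfl
  · exact absurd h.symm (hne _ _)
  · exact absurd h (hne _ _)
  · obtain ⟨h₁, h₂⟩ := hx _ _ _ _ h
    rw [PNat.natPred_inj.1 h₁, PNat.natPred_inj.1 h₂]

/-- Elements with all mixed sums equal to a single absorbing element that is not a multiple of any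
of them give rise to a fan semilattice or a fan of rays. -/
theorem exists_fan_or_fanOfRays {y : ℕ → S} {e : S} (hy : ∀ i j, i ≠ j → y i + y j = e)
    (hl : ∀ i, y i + e = e) (hr : ∀ i, e + y i = e) (hne : ∀ i k, multiple (y i) k ≠ e) :
    (∃ T : AddSubsemigroup S, Nonempty (T ≃+ Fan)) ∨
      ∃ T : AddSubsemigroup S, Nonempty (T ≃+ FanOfRays) := by
  have hl' (i k) : multiple (y i) k + e = e := by
    induction k with
    | zero => exact hl i
    | succ k ih => rw [multiple_succ, add_assoc, hl, ih]
  have hr' (i k) : e + multiple (y i) k = e := by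
    induction k with
    | zero => exact hr i
    | succ k ih => rw [multiple_succ, ← add_assoc, ih, hr]
  have hadd (i j k l) (hij : i ≠ j) : multiple (y i) k + multiple (y j) l = e := by
    have h : multiple (y i) k + y j = e := by
      cases k with
      | zero => exact hy i j hij
      | succ k => rw [multiple_succ, add_assoc, hy i j hij, hl']
    cases l with
    | zero => exact h
    | succ l => rw [multiple_succ', ← add_assoc, h, hr']
  -- A common multiple of two distinct terms, added to itself, would be a mixed sum, so `e` would be
  -- a multiple of `y i`.
  have hdisj (i j k l) (h : multiple (y i) k = multiple (y j) l) : i = j := by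
    by_contra hij
    refine hne i (k + k + 1) ?_
    rw [← multiple_add_multiple]
    conv_lhs => rw [h]
    rw [← hadd j i l k (Ne.symm hij), h]
  -- Terms with repeating multiples supply idempotents for a fan; the others generate rays.
  by_cases hinf : {i | ¬ Function.Injective (multiple (y i))}.Infinite
  · left
    let φ := hinf.natEmbedding
    choose k hk using fun i => exists_idempotent_multiple (φ i).2
    have hφ {i j} (h : (φ i : ℕ) = φ j) : i = j := φ.injective (Subtype.ext h)
    exact exists_fan (x := fun i => multiple (y (φ i)) (k i)) (fun i j h => hφ (hdisj _ _ _ _ h)) hk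
      (fun i j hij => hadd _ _ _ _ fun h => hij (hφ h)) fun i => hne _ _
  · right
    have hinf' : {i | Function.Injective (multiple (y i))}.Infinite := by
      have := (Set.not_infinite.1 hinf).infinite_compl
      simpa [Set.compl_ofPred] using this
    let φ := hinf'.natEmbedding
    have hφ {i j} (h : (φ i : ℕ) = φ j) : i = j := φ.injective (Subtype.ext h)
    refine exists_fanOfRays (x := fun i => multiple (y (φ i))) (fun i j k l h => ?_)
      (fun i => multiple_add_multiple _) (fun i j k l hij => hadd _ _ _ _ fun h => hij (hφ h))
      (fun i => hl' _) (fun i => hr' _) fun i => hne _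
    obtain rfl := hφ (hdisj _ _ _ _ h)
    exact ⟨rfl, (φ i).2 h⟩

end Rays

/-! ### Type (a) from a finite absorbing set. -/

section Absorbing

variable {S : Type*} [AddSemigroup S]

/-- The set `E` contains the sums of any two distinct terms of `x`, and it is closed under addition,
and under addition of terms of `x` on either side. -/
structure IsAbsorbing (x : ℕ → S) (E : Set S) : Prop where
  mixed : ∀ i j, i ≠ j → x i + x j ∈ E
  left : ∀ i, ∀ e ∈ E, x i + e ∈ E
  right : ∀ i, ∀ e ∈ E, e + x i ∈ E
  add : ∀ e ∈ E, ∀ e' ∈ E, e + e' ∈ E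

/-- The multiples `z` of terms `x i` that do not belong to `E`, while `z + x i` does. -/
def lastMultiples (x : ℕ → S) (E : Set S) : Set S :=
  {z | z ∉ E ∧ ∃ i k, multiple (x i) k = z ∧ z + x i ∈ E}

namespace IsAbsorbing

variable {x : ℕ → S} {E : Set S}

theorem comp (h : IsAbsorbing x E) {φ : ℕ → ℕ} (hφ : Function.Injective φ) :
    IsAbsorbing (fun i => x (φ i)) E :=
  ⟨fun _ _ hij => h.mixed _ _ (hφ.ne hij), fun _ => h.left _, fun _ => h.right _, h.add⟩

theorem multiple_left (h : IsAbsorbing x E) (i k : ℕ) {e : S} (he : e ∈ E) :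
    multiple (x i) k + e ∈ E := by
  induction k generalizing e with
  | zero => exact h.left i e he
  | succ k ih => rw [multiple_succ, add_assoc]; exact ih (h.left i e he)

theorem multiple_right (h : IsAbsorbing x E) (i k : ℕ) {e : S} (he : e ∈ E) :
    e + multiple (x i) k ∈ E := by
  induction k with
  | zero => exact h.right i e he
  | succ k ih => rw [multiple_succ, ← add_assoc]; exact h.right i _ ih

theorem multiple_add_multiple_mem (h : IsAbsorbing x E) {i k : ℕ} (j l : ℕ)
    (hik : multiple (x i) k + x i ∈ E) : multiple (x i) k + multiple (x j) l ∈ E := by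
  have h₁ : multiple (x i) k + x j ∈ E := by
    by_cases hij : i = j
    · rwa [← hij]
    · cases k with
      | zero => exact h.mixed i j hij
      | succ k => rw [multiple_succ, add_assoc]; exact h.multiple_left i k (h.mixed i j hij)
  cases l with
  | zero => exact h₁
  | succ l => rw [multiple_succ', ← add_assoc]; exact h.multiple_right j l h₁

theorem add_mem_of_mem_lastMultiples (h : IsAbsorbing x E) {y z : S} (hy : y ∈ lastMultiples x E)
    (hz : z ∈ lastMultiples x E) : y + z ∈ E := by
  obtain ⟨-, i, k, rfl, hik⟩ := hy
  obtain ⟨-, j, l, rfl, -⟩ := hz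
  exact h.multiple_add_multiple_mem j l hik

theorem lastMultiples_add_mem (h : IsAbsorbing x E) {y e : S} (hy : y ∈ lastMultiples x E)
    (he : e ∈ E) : y + e ∈ E := by
  obtain ⟨-, i, k, rfl, -⟩ := hy
  exact h.multiple_left i k he

theorem add_lastMultiples_mem (h : IsAbsorbing x E) {y e : S} (hy : y ∈ lastMultiples x E)
    (he : e ∈ E) : e + y ∈ E := by
  obtain ⟨-, i, k, rfl, -⟩ := hy
  exact h.multiple_right i k he

theorem union_lastMultiples (h : IsAbsorbing x E) : IsAbsorbing x (E ∪ lastMultiples x E) where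
  mixed i j hij := Or.inl (h.mixed i j hij)
  left j e he := by
    refine Or.inl ?_
    rcases he with he | ⟨-, i, k, rfl, hik⟩
    · exact h.left j e he
    · by_cases hij : j = i
      · subst hij
        rwa [← multiple_succ', multiple_succ]
      · cases k with
        | zero => exact h.mixed j i hij
        | succ k => rw [multiple_succ', ← add_assoc]; exact h.multiple_right i k (h.mixed j i hij)
  right j e he := by
    refine Or.inl ?_
    rcases he with he | ⟨-, i, k, rfl, hik⟩
    · exact h.right j e he
    · exact h.multiple_add_multiple_mem j 0 hik
  add e he e' he' := by
    refine Or.inl ?_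
    rcases he with he | he <;> rcases he' with he' | he'
    · exact h.add e he e' he'
    · exact h.add_lastMultiples_mem he' he
    · exact h.lastMultiples_add_mem he he'
    · exact h.add_mem_of_mem_lastMultiples he he'

/-- Every term outside E' = `E ∪ lastMultiples x E` has a last multiple outside E'. If these were
finitely many, two terms would share one, z; adding one of the terms to z, viewed as a multiple of
the other, lands in `E`, so z was already in E'. -/
theorem infinite_lastMultiples (h : IsAbsorbing x E) (hx : Function.Injective x)
    (hfin : (E ∪ lastMultiples x E).Finite) (hE : ∀ i, ∃ k, multiple (x i) k ∈ E) :
    (lastMultiples x (E ∪ lastMultiples x E)).Infinite := by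
  classical
  intro hfin'
  set E' := E ∪ lastMultiples x E with hE'
  have hlast : ∀ i, x i ∉ E' → ∃ k, multiple (x i) k ∉ E' ∧ multiple (x i) k + x i ∈ E' := by
    intro i hi
    have hex : ∃ k, multiple (x i) k ∈ E' := (hE i).imp fun k hk => Or.inl hk
    obtain ⟨k, hk⟩ : ∃ k, Nat.find hex = k + 1 :=
      Nat.exists_eq_succ_of_ne_zero fun h0 => hi (by simpa [h0] using Nat.find_spec hex)
    exact ⟨k, Nat.find_min hex (by omega), by simpa [hk, multiple_succ] using Nat.find_spec hex⟩
  choose! k hk hk' using hlast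
  have hinf : {i | x i ∉ E'}.Infinite := (hfin.preimage hx.injOn).infinite_compl
  obtain ⟨i, hi, j, hj, hij, heq⟩ := hinf.exists_ne_map_eq_of_mapsTo
    (f := fun i => multiple (x i) (k i)) (t := lastMultiples x E')
    (fun i hi => ⟨hk i hi, i, k i, rfl, hk' i hi⟩) hfin'
  refine hk i hi (Or.inr ⟨fun hmem => hk i hi (Or.inl hmem), i, k i, rfl, ?_⟩)
  change multiple (x i) (k i) = multiple (x j) (k j) at heq
  rw [heq]
  cases hkj : k j with
  | zero => exact h.mixed j i hij.symm
  | succ l => rw [multiple_succ, add_assoc]; exact h.multiple_left j l (h.mixed j i hij.symm)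

open scoped Pointwise in
-- Last multiples add into the absorbing set. If there are finitely many, enlarging `E` by them once
-- makes the new last multiples infinite in number.
theorem exists_addSubsemigroup_finite_add (h : IsAbsorbing x E) (hx : Function.Injective x)
    (hfin : E.Finite) (hE : ∀ i, ∃ k, multiple (x i) k ∈ E) :
    ∃ T : AddSubsemigroup S, (T : Set S).Infinite ∧ ((T : Set S) + (T : Set S)).Finite := by
  have key {E : Set S} (h : IsAbsorbing x E) (hfin : E.Finite)
      (hinf : (lastMultiples x E).Infinite) :=
    SemigroupIP.exists_addSubsemigroup_finite_add hinf hfin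
      (fun _ hy _ hz => h.add_mem_of_mem_lastMultiples hy hz)
      (fun _ hy _ he => h.lastMultiples_add_mem hy he)
      (fun _ he _ hy => h.add_lastMultiples_mem hy he) h.add
  by_cases hinf : (lastMultiples x E).Infinite
  · exact key h hfin hinf
  · have hfin' := hfin.union (Set.not_infinite.1 hinf)
    exact key h.union_lastMultiples hfin' (h.infinite_lastMultiples hx hfin' hE)

end IsAbsorbing

end Absorbing

/-! ### From principal multiples to a forbidden subsemigroup. -/

section Extraction

attribute [local instance] Ultrafilter.addSemigroup

variable {S : Type*} [AddSemigroup S]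

/-- `x` acts on the sequence `s` by the shift, from both sides. -/
def ActsAsShift (s : ℕ → S) (x : S) : Prop :=
  ∀ k, x + s k = s (k + 1) ∧ s k + x = s (k + 1)

/-- A sequence whose sums of two terms, in either order, do not depend on the indices, and whose
terms act by a shift on the multiples `s` of the sum of two terms in increasing order. -/
structure IsUniform (x : ℕ → S) (s : ℕ → S) (g : S) : Prop where
  shift : ∀ i, ActsAsShift s (x i)
  lt_add : ∀ i j, i < j → x i + x j = s 0
  gt_add : ∀ i j, i < j → x j + x i = g

theorem shift_add {s : ℕ → S} {x y : S} (hx : ActsAsShift s x) (hy : ActsAsShift s y)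
    (hxy : x + y = s 0) (k l : ℕ) : s k + s l = s (k + l + 2) := by
  induction l with
  | zero => rw [← hxy, ← add_assoc, (hx k).2, (hy _).2]
  | succ l ih => rw [← (hx l).2, ← add_assoc, ih, (hx _).2]; rfl

namespace IsUniform

variable {x s : ℕ → S} {g : S}

theorem add_seq (h : IsUniform x s g) (k l : ℕ) : s k + s l = s (k + l + 2) :=
  shift_add (h.shift 0) (h.shift 1) (h.lt_add 0 1 zero_lt_one) k l

theorem term_add (h : IsUniform x s g) (i : ℕ) : x i + g = s 1 := by
  rw [← h.gt_add 0 (i + 1) (Nat.succ_pos i), ← add_assoc, h.lt_add i _ (Nat.lt_succ_self i),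
    (h.shift 0 0).2]

theorem add_term (h : IsUniform x s g) (i : ℕ) : g + x (i + 1) = s 1 := by
  rw [← h.gt_add 0 1 zero_lt_one, add_assoc, h.lt_add 0 _ (Nat.succ_pos i), (h.shift 1 0).1]

/-- The term `x 0` is dropped: g + x j is evaluated by writing g = x 1 + x 0, which needs j > 0. -/
theorem isAbsorbing (h : IsUniform x s g) :
    IsAbsorbing (fun i => x (i + 1)) (insert g (Set.range s)) where
  mixed i j hij := by
    rcases lt_or_gt_of_ne hij with hij | hij
    · exact Or.inr ⟨0, (h.lt_add _ _ (Nat.succ_lt_succ hij)).symm⟩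
    · exact Or.inl (h.gt_add _ _ (Nat.succ_lt_succ hij))
  left i e he := by
    rcases he with rfl | ⟨k, rfl⟩
    · exact Or.inr ⟨1, (h.term_add _).symm⟩
    · exact Or.inr ⟨k + 1, (h.shift _ k).1.symm⟩
  right i e he := by
    rcases he with rfl | ⟨k, rfl⟩
    · exact Or.inr ⟨1, (h.add_term _).symm⟩
    · exact Or.inr ⟨k + 1, (h.shift _ k).2.symm⟩
  add e he e' he' := by
    have hg : g = x 1 + x 0 := (h.gt_add 0 1 zero_lt_one).symm
    right
    rcases he with rfl | ⟨k, rfl⟩ <;> rcases he' with rfl | ⟨l, rfl⟩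
    · refine ⟨2, ?_⟩
      conv_rhs => lhs; rw [hg]
      rw [add_assoc, h.term_add, (h.shift 1 1).1]
    · exact ⟨l + 2, by rw [hg, add_assoc, (h.shift 0 l).1, (h.shift 1 _).1]⟩
    · exact ⟨k + 2, by rw [hg, ← add_assoc, (h.shift 1 k).2, (h.shift 0 _).2]⟩
    · exact ⟨k + l + 2, (h.add_seq k l).symm⟩

theorem multiple_add_seq (h : IsUniform x s g) (i k l : ℕ) :
    multiple (x i) k + s l = s (k + l + 1) := by
  induction k generalizing l with
  | zero => rw [multiple_zero, (h.shift i l).1, zero_add]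
  | succ k ih => rw [multiple_succ, add_assoc, (h.shift i l).1, ih]; congr 1; ring

theorem seq_add_multiple (h : IsUniform x s g) (i k l : ℕ) :
    s l + multiple (x i) k = s (k + l + 1) := by
  induction k with
  | zero => rw [multiple_zero, (h.shift i l).2, zero_add]
  | succ k ih => rw [multiple_succ, ← add_assoc, ih, (h.shift i _).2]; congr 1; ring

/-- Two copies of `x i` erase the order dependence, since both `x i + s 0` and `x i + g` equal `s
1`. -/
theorem multiple_add_term (h : IsUniform x s g) {i j : ℕ} (hij : i ≠ j) (k : ℕ) :
    multiple (x i) (k + 1) + x j = s (k + 1) := by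
  rcases lt_or_gt_of_ne hij with hij | hij
  · rw [multiple_succ, add_assoc, h.lt_add i j hij, h.multiple_add_seq]
  · rw [multiple_succ, add_assoc, h.gt_add j i hij]
    cases k with
    | zero => exact h.term_add i
    | succ k => rw [multiple_succ, add_assoc, h.term_add, h.multiple_add_seq]

theorem multiple_add_multiple (h : IsUniform x s g) {i j : ℕ} (hij : i ≠ j) (k l : ℕ) :
    multiple (x i) (k + 1) + multiple (x j) l = s (k + l + 1) := by
  cases l with
  | zero => exact h.multiple_add_term hij k
  | succ l =>
    rw [multiple_succ' (x j), ← add_assoc, h.multiple_add_term hij, h.seq_add_multiple]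
    congr 1; ring

theorem multiple_eq (h : IsUniform x s g) (k : ℕ) : multiple (s 0) k = s (2 * k) := by
  induction k with
  | zero => rfl
  | succ k ih => rw [multiple_succ, ih, h.add_seq]; rfl

end IsUniform

variable (S) in
open scoped Pointwise in
/-- `S` has a subsemigroup of one of the three forbidden types. -/
def HasForbiddenSubsemigroup : Prop :=
  (∃ T : AddSubsemigroup S, (T : Set S).Infinite ∧ ((T : Set S) + (T : Set S)).Finite) ∨
    (∃ T : AddSubsemigroup S, Nonempty (T ≃+ Fan)) ∨
      ∃ T : AddSubsemigroup S, Nonempty (T ≃+ FanOfRays)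

theorem IsUniform.hasForbiddenSubsemigroup {x s : ℕ → S} {g : S} (h : IsUniform x s g)
    (hx : Function.Injective x) (hs : (Set.range s).Finite) : HasForbiddenSubsemigroup S := by
  have hx' : Function.Injective fun i => x (i + 1) := hx.comp (add_left_injective 1)
  by_cases hinf : {i | ∃ k, multiple (x (i + 1)) k ∈ insert g (Set.range s)}.Infinite
  · left
    let φ := hinf.natEmbedding
    have hφ : Function.Injective fun n => (φ n : ℕ) := Subtype.val_injective.comp φ.injective
    exact (h.isAbsorbing.comp hφ).exists_addSubsemigroup_finite_add (hx'.comp hφ) (hs.insert g)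
      fun i => (φ i).2
  · right
    have hinf' := (Set.not_infinite.1 hinf).infinite_compl
    let ψ := hinf'.natEmbedding
    let φ : ℕ → ℕ := fun n => (ψ n : ℕ) + 1
    have hφ : Function.Injective φ :=
      (add_left_injective 1).comp (Subtype.val_injective.comp ψ.injective)
    have hmem : ∀ i k, multiple (x (φ i)) k ∉ insert g (Set.range s) := fun i k hk =>
      (ψ i).2 ⟨k, hk⟩
    obtain ⟨m, hm⟩ : ∃ m, multiple (s 0) m + multiple (s 0) m = multiple (s 0) m := by
      refine exists_idempotent_multiple fun hinj => Set.infinite_range_of_injective hinj ?_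
      refine hs.subset ?_
      rintro _ ⟨k, rfl⟩
      exact ⟨2 * k, (h.multiple_eq k).symm⟩
    rw [h.multiple_eq, h.add_seq] at hm
    -- Since `s k` stands for `k + 2` summands, both the new terms and the idempotent `s (2 * m)`
    -- have length 2m + 2. All the required sums are thus `s (4 * m + 2)`, which equals `s (2 * m)`.
    refine exists_fan_or_fanOfRays (y := fun i => multiple (x (φ i)) (2 * m + 1)) (e := s (2 * m))
      (fun i j hij => ?_) (fun i => ?_) (fun i => ?_) fun i k hk => ?_
    · rw [h.multiple_add_multiple (hφ.ne hij), ← hm]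
      congr 1
    · rw [h.multiple_add_seq, ← hm]
      congr 1
      ring
    · rw [h.seq_add_multiple, ← hm]
      congr 1
      ring
    · obtain ⟨n, hn⟩ := exists_multiple_multiple (x (φ i)) (2 * m + 1) k
      exact hmem i n (hn ▸ hk ▸ Or.inr ⟨2 * m, rfl⟩)

theorem hasForbiddenSubsemigroup_of_multiples {p : Ultrafilter S} (hp : Nonprincipal p)
    {s : ℕ → S} (hs : (Set.range s).Finite) (hpp : p + p = pure (s 0))
    (hps : ∀ k, p + pure (s k) = pure (s (k + 1))) : HasForbiddenSubsemigroup S := by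
  have hsp : ∀ k, pure (s k) + p = pure (s (k + 1)) := by
    intro k
    induction k with
    | zero => rw [← hpp, add_assoc, hpp, hps]
    | succ k ih => rw [← hps, add_assoc, ih, hps]
  have hgood : ∀ᶠ x in (p : Filter S), ActsAsShift s x := by
    -- Only finitely many values of `s` must be handled, because equal values have equal successors.
    have : ∀ᶠ x in (p : Filter S), ∀ f ∈ Set.range s, ∀ k, s k = f →
        x + s k = s (k + 1) ∧ s k + x = s (k + 1) := by
      rw [Filter.eventually_all_finite hs]
      rintro _ ⟨k, rfl⟩
      filter_upwards [add_pure_eq_pure_iff.1 (hps k), pure_add_eq_pure_iff.1 (hsp k)] with x h h' l hl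
      have : s (l + 1) = s (k + 1) := Ultrafilter.pure_injective (by rw [← hps, ← hps, hl])
      rw [hl, this]
      exact ⟨h, h'⟩
    filter_upwards [this] with x hx k using hx _ ⟨k, rfl⟩ k rfl
  have hpp' := add_eq_pure_iff.1 hpp
  obtain ⟨x₀, hx₀, hadd₀⟩ := (hgood.and hpp').exists
  obtain ⟨y₀, hy₀, hxy₀⟩ := (hgood.and hadd₀).exists
  have hss := shift_add hx₀ hy₀ hxy₀
  have key (X : Set S) (hX : X.Infinite)
      (hsum : ∀ z ∈ X, ∃ y x, ActsAsShift s y ∧ ActsAsShift s x ∧ y + x = z)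
      (hXX : ∀ z ∈ X, ∀ z' ∈ X, z + z' ∈ Set.range s) : HasForbiddenSubsemigroup S := by
    refine Or.inl (exists_addSubsemigroup_finite_add hX hs hXX ?_ ?_ ?_)
    · rintro z hz _ ⟨k, rfl⟩
      obtain ⟨y, x, hy, hx, rfl⟩ := hsum z hz
      exact ⟨k + 2, by rw [add_assoc, (hx k).1, (hy _).1]⟩
    · rintro _ ⟨k, rfl⟩ z hz
      obtain ⟨y, x, hy, hx, rfl⟩ := hsum z hz
      exact ⟨k + 2, by rw [← add_assoc, (hy k).2, (hx _).2]⟩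
    · rintro _ ⟨k, rfl⟩ _ ⟨l, rfl⟩
      exact ⟨_, (hss k l).symm⟩
  have hsum {x x' y y'} (hx' : ActsAsShift s x') (hy : ActsAsShift s y) (h : x + y' = s 0) :
      (y + x) + (y' + x') = s 2 := by
    rw [add_assoc, ← add_assoc x, h, (hx' 0).2, (hy 1).1]
  -- If y + x takes infinitely many values for a fixed x, these have mutual sums y + (x + y') + x =
  -- `s 2` and yield type (a).
  by_cases h₁ : ∃ x, ActsAsShift s x ∧ (∀ᶠ y in (p : Filter S), x + y = s 0) ∧
      Nonprincipal (p + pure x)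
  · obtain ⟨x, hx, hxp, hnp⟩ := h₁
    refine key {z | ∃ y, ActsAsShift s y ∧ x + y = s 0 ∧ y + x = z} (hnp.infinite ?_) ?_ ?_
    · rw [Ultrafilter.eventually_add]
      filter_upwards [hgood, hxp] with y hy hxy
      simpa using ⟨y, hy, hxy, rfl⟩
    · rintro z ⟨y, hy, -, rfl⟩
      exact ⟨y, x, hy, hx, rfl⟩
    · rintro z ⟨y, hy, -, rfl⟩ z' ⟨y', -, hxy, rfl⟩
      exact ⟨2, (hsum hx hy hxy).symm⟩
  -- Now y + x is constant for p-most y; the value for irrelevant x is a dummy.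
  have hlim : ∀ x, ∃ z, ActsAsShift s x → (∀ᶠ y in (p : Filter S), x + y = s 0) →
      ∀ᶠ y in (p : Filter S), y + x = z := by
    intro x
    by_cases hx : ActsAsShift s x ∧ (∀ᶠ y in (p : Filter S), x + y = s 0)
    · obtain ⟨z, hz⟩ := not_nonprincipal.1 fun hnp => h₁ ⟨x, hx.1, hx.2, hnp⟩
      exact ⟨z, fun _ _ => add_pure_eq_pure_iff.1 hz⟩
    · exact ⟨x, fun h h' => absurd ⟨h, h'⟩ hx⟩
  choose g hg using hlim
  -- If these constants vary, they again yield type (a): y' can be chosen with y' + x' = g x' and x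
  -- + y' = `s 0` simultaneously.
  by_cases h₂ : Nonprincipal (p.map g)
  · refine key {z | ∃ x, (ActsAsShift s x ∧ ∀ᶠ y in (p : Filter S), x + y = s 0) ∧ g x = z}
      (h₂.infinite ?_) ?_ ?_
    · rw [Ultrafilter.coe_map, Filter.eventually_map]
      filter_upwards [hgood, hpp'] with x hx hxp using ⟨x, ⟨hx, hxp⟩, rfl⟩
    · rintro z ⟨x, ⟨hx, hxp⟩, rfl⟩
      obtain ⟨y, hy, hyx⟩ := (hgood.and (hg x hx hxp)).exists
      exact ⟨y, x, hy, hx, hyx⟩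
    · rintro z ⟨x, ⟨hx, hxp⟩, rfl⟩ z' ⟨x', ⟨hx', hxp'⟩, rfl⟩
      obtain ⟨y, hy, hyx⟩ := (hgood.and (hg x hx hxp)).exists
      obtain ⟨y', hy', hyx'⟩ := (hxp.and (hg x' hx' hxp')).exists
      exact ⟨2, by rw [← hyx, ← hyx', hsum hx' hy hy']⟩
  obtain ⟨g₀, hg₀⟩ := not_nonprincipal.1 h₂
  rw [eq_pure_iff, Ultrafilter.coe_map, Filter.eventually_map] at hg₀
  -- In the remaining case both orders have constant limits, and generic choices build a uniform
  -- sequence.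
  obtain ⟨x, hx, hr⟩ := exists_seq_of_forall_finset_exists
    (fun x => ActsAsShift s x ∧ (∀ᶠ y in (p : Filter S), x + y = s 0) ∧
      ∀ᶠ y in (p : Filter S), y + x = g₀)
    (fun x y => x ≠ y ∧ x + y = s 0 ∧ y + x = g₀) (by
      intro t ht
      have hlast : ∀ᶠ y in (p : Filter S), ∀ x ∈ t, x + y = s 0 ∧ y + x = g₀ :=
        (Filter.eventually_all_finset t).2 fun x hx => (ht x hx).2.1.and (ht x hx).2.2
      obtain ⟨y, hy, hyp, hgy, hyt, hylast⟩ := (hgood.and (hpp'.and (hg₀.and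
        ((hp.eventually_notMem t.finite_toSet).and hlast)))).exists
      exact ⟨y, ⟨hy, hyp, hgy ▸ hg y hy hyp⟩, fun x hx =>
        ⟨fun h => hyt (h ▸ hx), hylast x hx⟩⟩)
  exact IsUniform.hasForbiddenSubsemigroup ⟨fun i => (hx i).1, fun i j hij => (hr i j hij).2.1,
    fun i j hij => (hr i j hij).2.2⟩ (Function.Injective.of_lt_imp_ne fun i j hij => (hr i j hij).1) hs

theorem exists_proper_monochromatic_sumsequence (hS : ¬ HasForbiddenSubsemigroup S) {a : ℕ → S}
    (ha : Function.Injective a) {κ : Type*} [Finite κ] (c : S → κ) :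
    ∃ b : ℕ → S, IsSumsequence b a ∧ IsProper b ∧ Monochromatic c (FS b) := by
  have hΓ : IsLargeSubsemigroup (tailUltrafilters a) :=
    ⟨isClosed_tailUltrafilters a, fun _ hU _ hV => add_mem_tailUltrafilters hU hV, _,
      map_hyperfilter_mem_tailUltrafilters a, nonprincipal_map_hyperfilter ha⟩
  by_cases hid : ∀ U ∈ tailUltrafilters a, U + U = U → ¬ Nonprincipal U
  · obtain ⟨p, hp, s, hs, hpp, hps⟩ := hΓ.exists_principal_multiples hid
    exact absurd (hasForbiddenSubsemigroup_of_multiples hp hs hpp hps) hS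
  · push Not at hid
    obtain ⟨U, hU, hUU, hnp⟩ := hid
    -- On finitely many colours the image of U is principal, so one colour class belongs to U.
    obtain ⟨i, -, hi⟩ := Ultrafilter.eq_pure_of_finite_mem (f := U.map c) Set.finite_univ
      Filter.univ_mem
    have hA : {x | c x = i} ∈ U := by
      have := eq_pure_iff.1 hi
      rwa [Ultrafilter.coe_map, Filter.eventually_map] at this
    obtain ⟨b, hb, hproper, hFS⟩ := exists_proper_sumsequence hU hUU hnp hA
    exact ⟨b, hb, hproper, i, hFS⟩

theorem HasForbiddenSubsemigroup.exists_sumsCollapse (h : HasForbiddenSubsemigroup S) :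
    ∃ (a : ℕ → S) (Z : Set S), SumsCollapse a Z := by
  rcases h with ⟨T, hT, hfin⟩ | ⟨T, ⟨e⟩⟩ | ⟨T, ⟨e⟩⟩
  · exact exists_sumsCollapse_of_finite_add hT hfin
  · exact exists_sumsCollapse_of_fan e
  · exact exists_sumsCollapse_of_fanOfRays e

end Extraction

end SemigroupIP

/-! ### The equivalence. -/

open scoped Pointwise in
theorem mainTheorem1 (S : Type*) [AddSemigroup S] :
    List.TFAE [
      SemigroupIP.PartitionRegular {A : Set S | SemigroupIP.IsProperIP A},
      ∀ a : ℕ → S, Function.Injective a →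
        ∃ b : ℕ → S, SemigroupIP.IsSumsequence b a ∧ SemigroupIP.IsProper b,
      (¬ ∃ T : AddSubsemigroup S, (T : Set S).Infinite ∧ ((T : Set S) + (T : Set S)).Finite) ∧
        (¬ ∃ T : AddSubsemigroup S, Nonempty (T ≃+ SemigroupIP.Fan)) ∧
        (¬ ∃ T : AddSubsemigroup S, Nonempty (T ≃+ SemigroupIP.FanOfRays)),
      ∀ a : ℕ → S, Function.Injective a → ∀ (k : ℕ) (c : S → Fin k),
        ∃ b : ℕ → S, SemigroupIP.IsSumsequence b a ∧ Function.Injective b ∧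
          SemigroupIP.Monochromatic c (SemigroupIP.FS b),
      ∀ a : ℕ → S, Function.Injective a → ∀ (k : ℕ) (c : S → Fin k),
        ∃ b : ℕ → S, SemigroupIP.IsSumsequence b a ∧ SemigroupIP.IsProper b ∧
          SemigroupIP.Monochromatic c (SemigroupIP.FS b)] := by
  have hforb : ∀ {P : Prop}, (∀ (a : ℕ → S) (Z : Set S), SemigroupIP.SumsCollapse a Z → ¬ P) → P →
      (¬ ∃ T : AddSubsemigroup S, (T : Set S).Infinite ∧ ((T : Set S) + (T : Set S)).Finite) ∧
        (¬ ∃ T : AddSubsemigroup S, Nonempty (T ≃+ SemigroupIP.Fan)) ∧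
        (¬ ∃ T : AddSubsemigroup S, Nonempty (T ≃+ SemigroupIP.FanOfRays)) := by
    intro P h hP
    rw [← not_or, ← not_or]
    intro hS
    obtain ⟨a, Z, ha⟩ := SemigroupIP.HasForbiddenSubsemigroup.exists_sumsCollapse hS
    exact h a Z ha hP
  tfae_have 3 → 5 := fun h a ha k c => by
    rw [← not_or, ← not_or] at h
    exact SemigroupIP.exists_proper_monochromatic_sumsequence h ha c
  tfae_have 5 → 4 := fun h a ha k c =>
    (h a ha k c).imp fun b hb => ⟨hb.1, hb.2.1.injective, hb.2.2⟩
  tfae_have 5 → 2 := fun h a ha => (h a ha 1 fun _ => 0).imp fun b hb => ⟨hb.1, hb.2.1⟩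
  tfae_have 4 → 1 := SemigroupIP.partitionRegular_of_monochromatic
  tfae_have 1 → 3 := hforb fun a Z ha => ha.not_partitionRegular
  tfae_have 2 → 3 := hforb fun a Z ha h =>
    let ⟨_, hb, hp⟩ := h a ha.injective
    ha.not_isProper hb hp
  tfae_finish
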